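/- Let $\mathcal W_2(\mathbb R)$ be the set of Borel probability measures on $\mathbb R$ with finite second moment, and let $$W_2(\mu,\nu)=\Big(\inf_{\pi\in\Pi(\mu,\nu)}\int|x-y|^2\,d\pi(x,y)\Big)^{1/2},$$ where $\Pi(\mu,\nu)$ is the set of probability measures on $\mathbb R^2$ with marginals $\mu$ and $\nu$. Call $F:[0,\infty)\to[0,\infty)$ completely monotone if $F$ is continuous on $[0,\infty)$, $C^\infty$ on $(0,\infty)$, and $(-1)^nF^{(n)}(x)\ge 0$ for all $n\ge 0$ and $x>0$. A covariance kernel on a set $E$ is a symmetric function $K:E\times E\to\mathbb R$ such that $\sum_{i,j=1}^n\lambda_i\lambda_jK(x_i,x_j)\ge 0$ for all $n$, all $x_1,\dots,x_n\in E$ and all $\lambda_1,\dots,\lambda_n\in\mathbb R$. A square-integrable real process $(X(x))_{x\in E}$ indexed by a metric space $(E,d)$ is stationary if its mean is constant and $\operatorname{Cov}(X(g(x)),X(g(y)))=\operatorname{Cov}(X(x),X(y))$ for all $x,y\in E$ and every map $g:E\to E$ that preserves $d$. Theorem. Let $F$ be completely monotone and $0<H\le 1$. Then $$(\mu,\nu)\mapsto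 F\big(W_2(\mu,\nu)^{2H}\big)$$ is a covariance kernel on $\mathcal W_2(\mathbb R)$, and every Gaussian process indexed by $\mathcal W_2(\mathbb R)$ with constant mean and this covariance is stationary with respect to the distance $W_2$. In particular, for every $\lambda>0$ and $0<H\le 1$, the function $(\mu,\nu)\mapsto e^{-\lambda W_2(\mu,\nu)^{2H}}$ is a covariance kernel on $\mathcal W_2(\mathbb R)$, and every Gaussian process with constant mean and this covariance is stationary with respect to $W_2$. -/

import Mathlib

open MeasureTheory ProbabilityTheory Set
open scoped ContDiff

noncomputable section

/-- The set of Borel probability measures on the real line with a finite second moment. -/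
structure Wasserstein2 where
  /-- the underlying probability measure -/
  measure : ProbabilityMeasure ℝ
  /-- the second moment is finite -/
  integrable_sq : Integrable (fun x : ℝ => x ^ 2) (measure : Measure ℝ)

namespace Wasserstein2

/-- Probability measures on the plane with first marginal `μ` and second marginal `ν`. -/
def couplings (μ ν : Wasserstein2) : Set (ProbabilityMeasure (ℝ × ℝ)) :=
  {π | (π : Measure (ℝ × ℝ)).map Prod.fst = (μ.measure : Measure ℝ) ∧
    (π : Measure (ℝ × ℝ)).map Prod.snd = (ν.measure : Measure ℝ)}

/-- The quadratic transportation cost: the infimum of `∫ |x - y|² dπ(x, y)` over all couplings.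
The integrals are finite because both marginals have a finite second moment, and the product
measure is a coupling, so this is an infimum of a nonempty set of nonnegative reals. -/
def cost (μ ν : Wasserstein2) : ℝ :=
  sInf ((fun π : ProbabilityMeasure (ℝ × ℝ) =>
    ∫ p, |p.1 - p.2| ^ 2 ∂(π : Measure (ℝ × ℝ))) '' couplings μ ν)

/-- The quadratic Wasserstein (Monge-Kantorovich) distance. -/
instance instDist : Dist Wasserstein2 where
  dist μ ν := Real.sqrt (cost μ ν)

end Wasserstein2

/-- `F`, regarded as a function on `[0, ∞)`, is completely monotone: continuous on `[0, ∞)`,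
smooth on `(0, ∞)`, with `(-1)ⁿ F⁽ⁿ⁾ ≥ 0` on `(0, ∞)` for every `n`. (In particular `F ≥ 0` on
`[0, ∞)`. Functions that are smooth up to `0` with the same sign conditions on all of `[0, ∞)`
are a special case.) -/
def IsCompletelyMonotone (F : ℝ → ℝ) : Prop :=
  ContinuousOn F (Ici 0) ∧ ContDiffOn ℝ ∞ F (Ioi 0) ∧
    ∀ (n : ℕ) (x : ℝ), 0 < x → 0 ≤ (-1 : ℝ) ^ n * iteratedDeriv n F x

/-- A covariance kernel on `E`: a symmetric positive definite kernel, i.e. all the quadratic forms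
`∑ᵢⱼ λᵢ λⱼ K(xᵢ, xⱼ)` are nonnegative. -/
def IsCovarianceKernel {E : Type*} (K : E → E → ℝ) : Prop :=
  (∀ x y : E, K x y = K y x) ∧
    ∀ (n : ℕ) (x : Fin n → E) (c : Fin n → ℝ),
      0 ≤ ∑ i, ∑ j, c i * c j * K (x i) (x j)

/-- A real square-integrable process `X` indexed by a space with a distance is stationary: its mean
is constant and its covariance is invariant under every distance-preserving self-map. -/
def IsStationaryProcess {E Ω : Type*} [Dist E] [MeasurableSpace Ω] (X : E → Ω → ℝ)
    (P : Measure Ω) : Prop :=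
  (∀ x, MemLp (X x) 2 P) ∧
  (∃ m : ℝ, ∀ x, ∫ a, X x a ∂P = m) ∧
  ∀ g : E → E, (∀ x y, dist (g x) (g y) = dist x y) →
    ∀ x y, covariance (X (g x)) (X (g y)) P = covariance (X x) (X y) P

end

/-! On the line the comonotone coupling is optimal, so sending a measure to its quantile function is
an isometry into the Hilbert space L²(0,1). Squared Hilbert distances are of negative type, and so
are their powers of exponent `H ≤ 1`; hence `N = W₂^(2H)` is of negative type. The exponential case
is then Schoenberg's theorem. For general `F`, Bernstein's integral representation is avoided:
`F(N)` is the limit of `F(m(1 - K))` with `K = exp(-N/m)`, a kernel with values in (0,1]. Bernstein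
polynomials approximate `F(m(1 - K))`, and their coefficients in powers of `K` are nonnegative
because the iterated differences of `F` alternate in sign (`bernstein_sum`). Stationarity holds
because the covariance depends only on the distance. -/

/-! ### Closure properties of covariance kernels. -/

namespace IsCovarianceKernel

variable {E : Type*} {K L : E → E → ℝ}

theorem posSemidef (hK : IsCovarianceKernel K) {n : ℕ} (x : Fin n → E) :
    (Matrix.of fun i j => K (x i) (x j)).PosSemidef := by
  refine .of_dotProduct_mulVec_nonneg ?_ fun c => ?_
  · ext i j
    simp [hK.1 (x j) (x i)]
  · have := hK.2 n x c
    simpa [dotProduct, Matrix.mulVec, Finset.mul_sum, mul_assoc, mul_comm, mul_left_comm] using this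

theorem add (hK : IsCovarianceKernel K) (hL : IsCovarianceKernel L) :
    IsCovarianceKernel fun x y => K x y + L x y := by
  refine ⟨fun x y => by simp only [hK.1 x y, hL.1 x y], fun n x c => ?_⟩
  simp only [mul_add, Finset.sum_add_distrib]
  exact add_nonneg (hK.2 n x c) (hL.2 n x c)

theorem mul (hK : IsCovarianceKernel K) (hL : IsCovarianceKernel L) :
    IsCovarianceKernel fun x y => K x y * L x y := by
  refine ⟨fun x y => by simp only [hK.1 x y, hL.1 x y], fun n x c => ?_⟩
  have := ((hK.posSemidef x).hadamard (hL.posSemidef x)).dotProduct_mulVec_nonneg c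
  simpa [dotProduct, Matrix.mulVec, Finset.mul_sum, mul_assoc, mul_comm, mul_left_comm] using this

theorem rank_one (f : E → ℝ) : IsCovarianceKernel fun x y => f x * f y := by
  refine ⟨fun x y => mul_comm _ _, fun n x c => ?_⟩
  have : ∑ i, ∑ j, c i * c j * (f (x i) * f (x j)) = (∑ i, c i * f (x i)) ^ 2 := by
    rw [sq, Finset.sum_mul_sum]
    exact Finset.sum_congr rfl fun i _ => Finset.sum_congr rfl fun j _ => by ring
  rw [this]
  positivity

theorem const {a : ℝ} (ha : 0 ≤ a) : IsCovarianceKernel fun _ _ : E => a := by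
  simpa [Real.mul_self_sqrt ha] using rank_one fun _ : E => Real.sqrt a

theorem pow (hK : IsCovarianceKernel K) (n : ℕ) : IsCovarianceKernel fun x y => K x y ^ n := by
  induction n with
  | zero => simpa using const (E := E) zero_le_one
  | succ n ih => simpa [pow_succ] using ih.mul hK

theorem sum {ι : Type*} (s : Finset ι) {K : ι → E → E → ℝ}
    (hK : ∀ i ∈ s, IsCovarianceKernel (K i)) :
    IsCovarianceKernel fun x y => ∑ i ∈ s, K i x y := by
  classical
  induction s using Finset.induction_on with
  | empty => simpa using const (E := E) le_rfl
  | insert i s hi ih =>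
    simp only [Finset.sum_insert hi]
    exact (hK i (by simp)).add (ih fun j hj => hK j (by simp [hj]))

theorem of_tendsto {ι : Type*} {l : Filter ι} [l.NeBot] {k : ι → E → E → ℝ}
    (hk : ∀ i, IsCovarianceKernel (k i))
    (h : ∀ x y, Filter.Tendsto (fun i => k i x y) l (nhds (K x y))) : IsCovarianceKernel K := by
  refine ⟨fun x y => tendsto_nhds_unique (h x y) (by simpa only [(hk _).1 x y] using h y x),
    fun n x c => ?_⟩
  refine ge_of_tendsto' (f := fun i => ∑ a, ∑ b, c a * c b * k i (x a) (x b)) (x := l) ?_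
    fun i => (hk i).2 n x c
  exact tendsto_finsetSum _ fun a _ => tendsto_finsetSum _ fun b _ => (h _ _).const_mul _

theorem exp (hK : IsCovarianceKernel K) : IsCovarianceKernel fun x y => Real.exp (K x y) := by
  refine of_tendsto (l := Filter.atTop)
    (k := fun n x y => ∑ i ∈ Finset.range n, ((i.factorial : ℝ)⁻¹) * K x y ^ i)
    (fun n => sum _ fun i _ => (const (by positivity)).mul (hK.pow i)) fun x y => ?_
  have := (NormedSpace.expSeries_div_hasSum_exp (K x y)).tendsto_sum_nat
  simpa [Real.exp_eq_exp_ℝ, div_eq_inv_mul] using this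

end IsCovarianceKernel

/-! ### Kernels of negative type, Schoenberg's theorem and fractional powers. -/

/-- Nonnegative kernels of conditionally negative type that vanish on the diagonal. -/
structure IsNegativeType {E : Type*} (N : E → E → ℝ) : Prop where
  symm : ∀ x y, N x y = N y x
  diag : ∀ x, N x x = 0
  nonneg : ∀ x y, 0 ≤ N x y
  sum_nonpos : ∀ (n : ℕ) (x : Fin n → E) (c : Fin n → ℝ), ∑ i, c i = 0 →
    ∑ i, ∑ j, c i * c j * N (x i) (x j) ≤ 0

namespace IsNegativeType

variable {E : Type*} {N : E → E → ℝ}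

theorem centered (hN : IsNegativeType N) (o : E) :
    IsCovarianceKernel fun x y => N x o + N y o - N x y := by
  refine ⟨fun x y => by simp only [hN.symm x y]; ring, fun n x c => ?_⟩
  -- Adjoining `o` with weight `-∑ c` makes the total weight zero.
  have h := hN.sum_nonpos (n + 1) (Fin.cons o x) (Fin.cons (-∑ i, c i) c)
    (by simp [Fin.sum_univ_succ])
  simp only [Fin.sum_univ_succ, Fin.cons_zero, Fin.cons_succ, hN.diag, hN.symm o] at h
  have e1 : ∑ i, ∑ j, c i * c j * (N (x i) o + N (x j) o - N (x i) (x j))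
      = 2 * ((∑ i, c i) * ∑ i, c i * N (x i) o) - ∑ i, ∑ j, c i * c j * N (x i) (x j) := by
    have : ∑ i, ∑ j, c i * c j * (N (x i) o + N (x j) o - N (x i) (x j))
      = ∑ i, ∑ j, (c i * N (x i) o * c j) + ∑ i, ∑ j, (c i * (c j * N (x j) o))
        - ∑ i, ∑ j, c i * c j * N (x i) (x j) := by
      simp only [← Finset.sum_add_distrib, ← Finset.sum_sub_distrib]
      exact Finset.sum_congr rfl fun i _ => Finset.sum_congr rfl fun j _ => by ring
    rw [this, ← Finset.sum_mul_sum, ← Finset.sum_mul_sum]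
    ring
  have e2 : ∑ i, -(∑ i, c i) * c i * N (x i) o = -((∑ i, c i) * ∑ i, c i * N (x i) o) := by
    generalize ∑ i, c i = S
    rw [Finset.mul_sum, ← Finset.sum_neg_distrib]
    exact Finset.sum_congr rfl fun i _ => by ring
  have e3 : ∑ i, c i * -(∑ i, c i) * N (x i) o = -((∑ i, c i) * ∑ i, c i * N (x i) o) := by
    rw [← e2]
    exact Finset.sum_congr rfl fun i _ => by ring
  rw [Finset.sum_add_distrib, e2, e3] at h
  rw [e1]
  linarith

/-- **Schoenberg's theorem**: `exp (-t N)` is positive definite if `N` is of negative type. -/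
theorem exp_neg [Nonempty E] (hN : IsNegativeType N) {t : ℝ} (ht : 0 ≤ t) :
    IsCovarianceKernel fun x y => Real.exp (-(t * N x y)) := by
  obtain ⟨o⟩ := ‹Nonempty E›
  -- Factor `exp(-tN(x,y))` as `exp(-tN(x,o)) exp(-tN(y,o))` times the exponential of `t` times the
  -- centered kernel.
  have h := (IsCovarianceKernel.rank_one fun x => Real.exp (-(t * N x o))).mul
    ((IsCovarianceKernel.const ht).mul (hN.centered o)).exp
  simp only [← Real.exp_add] at h
  convert h using 4
  ring

/-- The Laplace integral `∫ exp(-(t + N)u) du` over `u > 0` exhibits this kernel as a mixture of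
Schoenberg kernels. -/
theorem inv_add [Nonempty E] (hN : IsNegativeType N) {t : ℝ} (ht : 0 < t) :
    IsCovarianceKernel fun x y => (t + N x y)⁻¹ := by
  refine ⟨fun x y => by simp only [hN.symm x y], fun n x c => ?_⟩
  have key (a b : E) : IntegrableOn (fun u => Real.exp (-(t + N a b) * u)) (Ioi 0) ∧
      (t + N a b)⁻¹ = ∫ u in Ioi 0, Real.exp (-(t + N a b) * u) := by
    have hp : -(t + N a b) < 0 := by linarith [hN.nonneg a b]
    refine ⟨integrableOn_exp_mul_Ioi hp 0, ?_⟩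
    rw [integral_exp_mul_Ioi hp 0]
    simp [neg_div, div_neg, -neg_add_rev]
  have hI (i j : Fin n) : Integrable
      (fun u => c i * c j * Real.exp (-(t + N (x i) (x j)) * u)) (volume.restrict (Ioi 0)) :=
    (key (x i) (x j)).1.const_mul _
  have e : ∑ i, ∑ j, c i * c j * (t + N (x i) (x j))⁻¹
      = ∫ u in Ioi 0, ∑ i, ∑ j, c i * c j * Real.exp (-(t + N (x i) (x j)) * u) := by
    rw [integral_finsetSum _ fun i _ => integrable_finsetSum _ fun j _ => hI i j]
    refine Finset.sum_congr rfl fun i _ => ?_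
    rw [integral_finsetSum _ fun j _ => hI i j]
    refine Finset.sum_congr rfl fun j _ => ?_
    rw [integral_const_mul, ← (key (x i) (x j)).2]
  rw [e]
  refine setIntegral_nonneg measurableSet_Ioi fun u hu => ?_
  have hu : (0 : ℝ) < u := hu
  have := ((IsCovarianceKernel.const (E := E) (Real.exp_nonneg (-(t * u)))).mul
    (hN.exp_neg hu.le)).2 n x c
  simp only [← Real.exp_add] at this
  convert this using 6
  ring

theorem rpow [Nonempty E] (hN : IsNegativeType N) {p : ℝ} (hp : 0 < p) (hp1 : p ≤ 1) :
    IsNegativeType fun x y => N x y ^ p := by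
  refine ⟨fun x y => by simp only [hN.symm x y], fun x => by simp [hN.diag, hp.ne'],
    fun x y => Real.rpow_nonneg (hN.nonneg x y) p, fun n x c hc => ?_⟩
  rcases hp1.eq_or_lt with rfl | hp1
  · simpa using hN.sum_nonpos n x c hc
  obtain ⟨μ, hμ⟩ := Real.exists_measure_rpow_eq_integral_rpowIntegrand₀₁ (p := p) ⟨hp, hp1⟩
  have hI (i j : Fin n) : Integrable
      (fun t => c i * c j * Real.rpowIntegrand₀₁ p t (N (x i) (x j))) (μ.restrict (Ioi 0)) :=
    (hμ _ (hN.nonneg (x i) (x j))).1.const_mul _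
  have e : ∑ i, ∑ j, c i * c j * N (x i) (x j) ^ p
      = ∫ t in Ioi 0, ∑ i, ∑ j, c i * c j * Real.rpowIntegrand₀₁ p t (N (x i) (x j)) ∂μ := by
    rw [integral_finsetSum _ fun i _ => integrable_finsetSum _ fun j _ => hI i j]
    refine Finset.sum_congr rfl fun i _ => ?_
    rw [integral_finsetSum _ fun j _ => hI i j]
    refine Finset.sum_congr rfl fun j _ => ?_
    rw [integral_const_mul, ← (hμ _ (hN.nonneg (x i) (x j))).2]
  rw [e]
  refine setIntegral_nonpos measurableSet_Ioi fun t ht => ?_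
  have ht : (0 : ℝ) < t := ht
  have h1 := (hN.inv_add ht).2 n x c
  -- The integrand is `t^p (1/t - 1/(t + N))`: zero-sum weights kill the constant term, leaving
  -- minus a covariance kernel.
  have h2 : ∑ i, ∑ j, c i * c j * Real.rpowIntegrand₀₁ p t (N (x i) (x j))
      = t ^ p * (t⁻¹ * ((∑ i, c i) * ∑ j, c j) - ∑ i, ∑ j, c i * c j * (t + N (x i) (x j))⁻¹) := by
    rw [Finset.sum_mul_sum]
    simp only [Finset.mul_sum, ← Finset.sum_sub_distrib]
    exact Finset.sum_congr rfl fun i _ => Finset.sum_congr rfl fun j _ => by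
      rw [Real.rpowIntegrand₀₁]; ring
  rw [h2, hc]
  have : 0 ≤ t ^ p := by positivity
  nlinarith

end IsNegativeType

theorem isNegativeType_norm_sub_sq {E V : Type*} [NormedAddCommGroup V] [InnerProductSpace ℝ V]
    (f : E → V) : IsNegativeType fun x y => ‖f x - f y‖ ^ 2 := by
  refine ⟨fun x y => by rw [norm_sub_rev], fun x => by simp, fun x y => by positivity,
    fun n x c hc => ?_⟩
  have e : ∑ i, ∑ j, c i * c j * ‖f (x i) - f (x j)‖ ^ 2
      = (∑ i, c i * ‖f (x i)‖ ^ 2) * (∑ j, c j) + (∑ i, c i) * (∑ j, c j * ‖f (x j)‖ ^ 2)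
        - 2 * ‖∑ i, c i • f (x i)‖ ^ 2 := by
    have h : ‖∑ i, c i • f (x i)‖ ^ 2
        = ∑ i, ∑ j, c i * c j * inner ℝ (f (x i)) (f (x j)) := by
      rw [← real_inner_self_eq_norm_sq, sum_inner]
      simp only [inner_sum, real_inner_smul_left, real_inner_smul_right, mul_assoc, mul_left_comm]
    rw [h, Finset.sum_mul_sum, Finset.sum_mul_sum]
    simp only [Finset.mul_sum, ← Finset.sum_add_distrib, ← Finset.sum_sub_distrib]
    exact Finset.sum_congr rfl fun i _ => Finset.sum_congr rfl fun j _ => by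
      rw [norm_sub_sq_real]; ring
  rw [e, hc]
  have : 0 ≤ ‖∑ i, c i • f (x i)‖ ^ 2 := by positivity
  linarith

/-! ### Completely monotone functions of negative-type kernels. -/

namespace IsCompletelyMonotone

variable {F : ℝ → ℝ}

theorem comp_add_const (hF : IsCompletelyMonotone F) {h : ℝ} (hh : 0 ≤ h) :
    IsCompletelyMonotone fun x => F (x + h) := by
  refine ⟨hF.1.comp (by fun_prop) fun x hx => add_nonneg (mem_Ici.1 hx) hh,
    hF.2.1.comp (by fun_prop) fun x hx => add_pos_of_pos_of_nonneg (mem_Ioi.1 hx) hh,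
    fun n x hx => ?_⟩
  rw [iteratedDeriv_comp_add_const]
  exact hF.2.2 n (x + h) (by linarith)

theorem antitoneOn_iteratedDeriv (hF : IsCompletelyMonotone F) (n : ℕ) :
    AntitoneOn (fun x => (-1 : ℝ) ^ n * iteratedDeriv n F x) (Ioi 0) := by
  have hd : DifferentiableOn ℝ (iteratedDeriv n F) (Ioi 0) :=
    (hF.2.1.differentiableOn_iteratedDerivWithin (m := n) (WithTop.coe_lt_coe.2 (ENat.natCast_lt_top n))
      isOpen_Ioi.uniqueDiffOn).congr fun x hx => (iteratedDerivWithin_of_isOpen isOpen_Ioi hx).symm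
  refine antitoneOn_of_deriv_nonpos (convex_Ioi 0) (hd.continuousOn.const_mul _)
    (by simpa using hd.const_mul _) fun x hx => ?_
  rw [interior_Ioi] at hx
  have := hF.2.2 (n + 1) x hx
  rw [deriv_const_mul _ ((hd x hx).differentiableAt (Ioi_mem_nhds hx)), ← iteratedDeriv_succ]
  rw [pow_succ] at this
  linarith

theorem sub_comp_add_const (hF : IsCompletelyMonotone F) {h : ℝ} (hh : 0 ≤ h) :
    IsCompletelyMonotone fun x => F x - F (x + h) := by
  have hG := hF.comp_add_const hh
  refine ⟨hF.1.sub hG.1, hF.2.1.sub hG.2.1, fun n x hx => ?_⟩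
  have hc {G : ℝ → ℝ} (hG : IsCompletelyMonotone G) : ContDiffAt ℝ n G x :=
    (hG.2.1.contDiffAt (Ioi_mem_nhds hx)).of_le (WithTop.coe_le_coe.2 le_top)
  rw [iteratedDeriv_fun_sub (hc hF) (hc hG), iteratedDeriv_comp_add_const, mul_sub, sub_nonneg]
  exact hF.antitoneOn_iteratedDeriv n hx (mem_Ioi.2 (by linarith)) (by linarith)

theorem nonneg (hF : IsCompletelyMonotone F) {x : ℝ} (hx : 0 ≤ x) : 0 ≤ F x := by
  have hpos : ∀ y ∈ Ioi (0 : ℝ), 0 ≤ F y := fun y hy => by simpa using hF.2.2 0 y hy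
  rcases hx.eq_or_lt with rfl | hx
  · have : Filter.Tendsto F (nhdsWithin 0 (Ioi 0)) (nhds (F 0)) :=
      (hF.1 0 self_mem_Ici).mono_left (nhdsWithin_mono _ Ioi_subset_Ici_self)
    exact ge_of_tendsto this (Filter.eventually_of_mem self_mem_nhdsWithin hpos)
  · exact hpos x hx

/-- The Bernstein polynomials of a completely monotone function, expanded in `1 - x`, have
nonnegative coefficients, so they preserve positive definiteness. -/
theorem bernstein_sum {E : Type*} {K : E → E → ℝ} (hK : IsCovarianceKernel K) {h : ℝ} (hh : 0 ≤ h)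
    (n : ℕ) : ∀ {F : ℝ → ℝ}, IsCompletelyMonotone F → IsCovarianceKernel fun x y =>
      ∑ p ∈ Finset.HasAntidiagonal.antidiagonal n,
        (n.choose p.1 : ℝ) * ((1 - K x y) ^ p.1 * K x y ^ p.2 * F (p.1 * h)) := by
  induction n with
  | zero => intro F hF; simpa using IsCovarianceKernel.const (hF.nonneg le_rfl)
  | succ n ih =>
    intro F hF
    -- Writing `S` for the sum of order `n`, the next one is `(1 - K) S(F(· + h)) + K S(F) = S(F(· +
    -- h)) + K S(F - F(· + h))`, and both arguments of `S` are again completely monotone.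
    have := (ih (hF.comp_add_const hh)).add (hK.mul (ih (hF.sub_comp_add_const hh)))
    convert this using 3 with x y
    rw [Finset.sum_antidiagonal_choose_succ_mul
      (fun i j => (1 - K x y) ^ i * K x y ^ j * F (i * h)), Finset.mul_sum,
      ← Finset.sum_add_distrib, ← Finset.sum_add_distrib]
    refine Finset.sum_congr rfl fun p hp => ?_
    have hp : p.1 + p.2 = n := by simpa using hp
    have e : n.choose p.2 = n.choose p.1 := by
      rw [← hp, Nat.choose_symm_add]
    rw [e]
    push_cast
    ring_nf

theorem comp_one_sub {E : Type*} {K : E → E → ℝ} (hF : IsCompletelyMonotone F)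
    (hK : IsCovarianceKernel K) (h0 : ∀ x y, 0 ≤ K x y) (h1 : ∀ x y, K x y ≤ 1)
    {m : ℝ} (hm : 0 ≤ m) : IsCovarianceKernel fun x y => F (m * (1 - K x y)) := by
  let f : C(unitInterval, ℝ) := ⟨fun x => F (m * x), by
    rw [← continuousOn_univ]
    exact hF.1.comp (by fun_prop) fun x _ => mul_nonneg hm x.2.1⟩
  refine IsCovarianceKernel.of_tendsto (l := Filter.atTop)
    (fun n : ℕ => bernstein_sum hK (div_nonneg hm n.cast_nonneg) n hF) fun x y => ?_
  let z : unitInterval := ⟨1 - K x y, by linarith [h1 x y], by linarith [h0 x y]⟩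
  have := (continuous_eval_const (F := C(unitInterval, ℝ)) z).tendsto f |>.comp
    (bernsteinApproximation_uniform f)
  refine this.congr fun n => ?_
  rw [Finset.Nat.sum_antidiagonal_eq_sum_range_succ
    (fun i j => (n.choose i : ℝ) * ((1 - K x y) ^ i * K x y ^ j * F (i * (m / n)))),
    Finset.sum_range]
  simp only [Function.comp_apply, bernsteinApproximation.apply, bernstein_apply, smul_eq_mul]
  refine Finset.sum_congr rfl fun k _ => ?_
  simp only [z, f, bernstein.z, ContinuousMap.coe_mk, sub_sub_cancel]
  rw [mul_div_assoc', mul_div_assoc', mul_comm m]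
  ring

theorem comp_negativeType {E : Type*} [Nonempty E] {N : E → E → ℝ} (hF : IsCompletelyMonotone F)
    (hN : IsNegativeType N) : IsCovarianceKernel fun x y => F (N x y) := by
  have hexp (x y : E) (m : ℕ) : Real.exp (-((m : ℝ)⁻¹ * N x y)) ≤ 1 := by
    rw [Real.exp_le_one_iff]
    have := hN.nonneg x y
    have : 0 ≤ (m : ℝ)⁻¹ * N x y := by positivity
    linarith
  refine IsCovarianceKernel.of_tendsto (l := Filter.atTop) (fun m : ℕ => hF.comp_one_sub
    (hN.exp_neg (t := (m : ℝ)⁻¹) (by positivity)) (fun x y => by positivity)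
    (fun x y => hexp x y m) m.cast_nonneg) fun x y => ?_
  have hlim : Filter.Tendsto (fun m : ℕ => (m : ℝ) * (1 - Real.exp (-((m : ℝ)⁻¹ * N x y))))
      Filter.atTop (nhds (N x y)) := by
    have hd : HasDerivAt (fun u => 1 - Real.exp (-(u * N x y))) (N x y) 0 := by
      have := (((hasDerivAt_id (0 : ℝ)).mul_const (N x y)).neg.exp).const_sub 1
      simpa using this
    have := hd.tendsto_slope_zero_right.comp
      (tendsto_inv_atTop_nhdsGT_zero.comp (tendsto_natCast_atTop_atTop (R := ℝ)))
    simpa [Function.comp_def] using this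
  -- Continuity of `F` at 0 is only one-sided, so the limit must be taken within [0, ∞).
  have hin : Filter.Tendsto (fun m : ℕ => (m : ℝ) * (1 - Real.exp (-((m : ℝ)⁻¹ * N x y))))
      Filter.atTop (nhdsWithin (N x y) (Ici 0)) :=
    tendsto_nhdsWithin_iff.2 ⟨hlim, Filter.Eventually.of_forall fun m =>
      mul_nonneg m.cast_nonneg (sub_nonneg.2 (hexp x y m))⟩
  exact (hF.1 _ (hN.nonneg x y)).tendsto.comp hin

end IsCompletelyMonotone

/-! ### Quantile functions and optimality of the comonotone coupling. -/

/-- The quantile function of a measure on the real line. -/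
noncomputable def quantile (μ : Measure ℝ) (u : ℝ) : ℝ := sInf {x | u ≤ cdf μ x}

/-- Lebesgue measure on the unit interval, as a measure on the real line. -/
noncomputable def unitUniform : Measure ℝ := volume.restrict (Ioo 0 1)

instance : IsProbabilityMeasure unitUniform := ⟨by simp [unitUniform]⟩

/-- Right continuity of the cdf makes the infimum attained; `0 < u < 1` makes the set bounded below
and nonempty. -/
theorem quantile_le_iff (μ : Measure ℝ) {u : ℝ} (hu : u ∈ Ioo (0 : ℝ) 1) (x : ℝ) :
    quantile μ u ≤ x ↔ u ≤ cdf μ x := by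
  have hne : {x | u ≤ cdf μ x}.Nonempty :=
    (((tendsto_cdf_atTop μ).eventually (lt_mem_nhds hu.2)).exists).imp fun _ h => le_of_lt h
  have hbdd : BddBelow {x | u ≤ cdf μ x} := by
    obtain ⟨b, hb⟩ := ((tendsto_cdf_atBot μ).eventually (gt_mem_nhds hu.1)).exists
    refine ⟨b, fun x hx => le_of_not_gt fun h => ?_⟩
    exact absurd (hx.trans (monotone_cdf μ h.le)) (not_le.2 hb)
  have hq : u ≤ cdf μ (quantile μ u) := by
    have ht : Filter.Tendsto (cdf μ) (nhdsWithin (quantile μ u) (Ioi (quantile μ u)))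
        (nhds (cdf μ (quantile μ u))) :=
      ((cdf μ).right_continuous (quantile μ u)).mono_left (nhdsWithin_mono _ Ioi_subset_Ici_self)
    refine ge_of_tendsto ht (Filter.eventually_of_mem self_mem_nhdsWithin fun y hy => ?_)
    obtain ⟨s, hs, hsy⟩ := (csInf_lt_iff hbdd hne).1 hy
    exact le_trans hs (monotone_cdf μ hsy.le)
  exact ⟨fun h => hq.trans (monotone_cdf μ h), fun h => csInf_le hbdd h⟩

theorem monotoneOn_quantile (μ : Measure ℝ) : MonotoneOn (quantile μ) (Ioo 0 1) :=
  fun _ hu _ hv huv => (quantile_le_iff μ hu _).2 (huv.trans ((quantile_le_iff μ hv _).1 le_rfl))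

theorem aemeasurable_quantile (μ : Measure ℝ) : AEMeasurable (quantile μ) unitUniform :=
  aemeasurable_restrict_of_monotoneOn measurableSet_Ioo (monotoneOn_quantile μ)

theorem unitUniform_Ioc {a b : ℝ} (ha : 0 ≤ a) (hb : b ≤ 1) :
    unitUniform (Ioc a b) = ENNReal.ofReal (b - a) := by
  rw [unitUniform, Measure.restrict_congr_set Ioo_ae_eq_Ioc,
    Measure.restrict_apply measurableSet_Ioc, Ioc_inter_Ioc, max_eq_left ha, min_eq_left hb,
    Real.volume_Ioc]

theorem ae_unitUniform : ∀ᵐ u ∂unitUniform, u ∈ Ioo (0 : ℝ) 1 :=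
  ae_restrict_mem measurableSet_Ioo

theorem map_quantile (μ : Measure ℝ) [IsProbabilityMeasure μ] :
    unitUniform.map (quantile μ) = μ := by
  have : IsProbabilityMeasure (unitUniform.map (quantile μ)) :=
    Measure.isProbabilityMeasure_map (aemeasurable_quantile μ)
  refine Measure.ext_of_Iic _ _ fun x => ?_
  rw [Measure.map_apply_of_aemeasurable (aemeasurable_quantile μ) measurableSet_Iic,
    ← ofReal_cdf μ x, ← sub_zero (cdf μ x), ← unitUniform_Ioc le_rfl (cdf_le_one μ x)]
  refine measure_congr ?_
  filter_upwards [ae_unitUniform] with u hu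
  refine propext ?_
  change quantile μ u ≤ x ↔ 0 < u ∧ u ≤ cdf μ x
  rw [quantile_le_iff μ hu, and_iff_right hu.1]

theorem measurableSet_le_and_lt {Ω : Type*} [MeasurableSpace Ω] {X Y S T : Ω → ℝ}
    (hX : Measurable X) (hY : Measurable Y) (hS : Measurable S) (hT : Measurable T) :
    MeasurableSet {a | Y a ≤ S a ∧ T a < X a} :=
  (measurableSet_le hY hS).inter (measurableSet_lt hT hX)

/-- The squared positive part is the area of the square `[Y, X)²`, so Tonelli reduces the cost to
probabilities of events `Y ≤ s, t < X`. -/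
theorem lintegral_ofReal_sub_sq {Ω : Type*} [MeasurableSpace Ω] (P : Measure Ω) [SFinite P]
    {X Y : Ω → ℝ} (hX : Measurable X) (hY : Measurable Y) :
    ∫⁻ a, ENNReal.ofReal (X a - Y a) ^ 2 ∂P
      = ∫⁻ z : ℝ × ℝ, P {a | Y a ≤ min z.1 z.2 ∧ max z.1 z.2 < X a} := by
  have hm : MeasurableSet {q : Ω × (ℝ × ℝ) | Y q.1 ≤ min q.2.1 q.2.2 ∧ max q.2.1 q.2.2 < X q.1} :=
    measurableSet_le_and_lt (Ω := Ω × (ℝ × ℝ)) (X := fun q => X q.1) (Y := fun q => Y q.1)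
      (S := fun q => min q.2.1 q.2.2) (T := fun q => max q.2.1 q.2.2)
      (by fun_prop) (by fun_prop) (by fun_prop) (by fun_prop)
  have h := (Measure.prod_apply (μ := P) (ν := (volume : Measure (ℝ × ℝ))) hm).symm.trans
    (Measure.prod_apply_symm hm)
  refine Eq.trans (lintegral_congr fun a => ?_) h
  have : Prod.mk a ⁻¹' {q : Ω × (ℝ × ℝ) | Y q.1 ≤ min q.2.1 q.2.2 ∧ max q.2.1 q.2.2 < X q.1}
      = Ico (Y a) (X a) ×ˢ Ico (Y a) (X a) := by
    ext z
    simp only [mem_preimage, mem_ofPred_eq, le_min_iff, max_lt_iff, mem_prod, mem_Ico]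
    tauto
  rw [this, Measure.volume_eq_prod, Measure.prod_prod, Real.volume_Ico, sq]

theorem ENNReal.ofReal_abs_sub_sq (x y : ℝ) :
    ENNReal.ofReal (|x - y| ^ 2) = ENNReal.ofReal (x - y) ^ 2 + ENNReal.ofReal (y - x) ^ 2 := by
  rw [ENNReal.ofReal_pow (abs_nonneg _)]
  rcases le_total x y with h | h
  · rw [ENNReal.ofReal_of_nonpos (sub_nonpos.2 h), abs_of_nonpos (sub_nonpos.2 h)]
    simp
  · rw [ENNReal.ofReal_of_nonpos (sub_nonpos.2 h), abs_of_nonneg (sub_nonneg.2 h)]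
    simp

/-- The comonotone coupling of two measures on the real line. -/
noncomputable def quantileCoupling (μ ν : Measure ℝ) : Measure (ℝ × ℝ) :=
  unitUniform.map fun u => (quantile μ u, quantile ν u)

theorem aemeasurable_quantile_prodMk (μ ν : Measure ℝ) :
    AEMeasurable (fun u => (quantile μ u, quantile ν u)) unitUniform :=
  (aemeasurable_quantile μ).prodMk (aemeasurable_quantile ν)

instance (μ ν : Measure ℝ) : IsProbabilityMeasure (quantileCoupling μ ν) :=
  Measure.isProbabilityMeasure_map (aemeasurable_quantile_prodMk μ ν)

theorem map_fst_quantileCoupling (μ ν : Measure ℝ) [IsProbabilityMeasure μ] :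
    (quantileCoupling μ ν).map Prod.fst = μ := by
  rw [quantileCoupling, AEMeasurable.map_map_of_aemeasurable measurable_fst.aemeasurable
    (aemeasurable_quantile_prodMk μ ν)]
  exact map_quantile μ

theorem map_snd_quantileCoupling (μ ν : Measure ℝ) [IsProbabilityMeasure ν] :
    (quantileCoupling μ ν).map Prod.snd = ν := by
  rw [quantileCoupling, AEMeasurable.map_map_of_aemeasurable measurable_snd.aemeasurable
    (aemeasurable_quantile_prodMk μ ν)]
  exact map_quantile ν

/-- Up to a null set the event is the interval `(cdf μ t, cdf ν s]` of levels `u`. This is equality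
in the bound `ofReal_cdf_map_sub_le`, valid for every coupling. -/
theorem quantileCoupling_snd_le_lt_fst (μ ν : Measure ℝ) (s t : ℝ) :
    quantileCoupling μ ν {p | p.2 ≤ s ∧ t < p.1} = ENNReal.ofReal (cdf ν s - cdf μ t) := by
  rw [quantileCoupling, Measure.map_apply_of_aemeasurable (aemeasurable_quantile_prodMk μ ν)
    (measurableSet_le_and_lt measurable_fst measurable_snd measurable_const measurable_const),
    ← unitUniform_Ioc (cdf_nonneg μ t) (cdf_le_one ν s)]
  refine measure_congr ?_
  filter_upwards [ae_unitUniform] with u hu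
  refine propext ?_
  change (quantile ν u ≤ s ∧ t < quantile μ u) ↔ (cdf μ t < u ∧ u ≤ cdf ν s)
  rw [quantile_le_iff ν hu, ← not_le, quantile_le_iff μ hu, not_le, and_comm]

theorem quantileCoupling_fst_le_lt_snd (μ ν : Measure ℝ) (s t : ℝ) :
    quantileCoupling μ ν {p | p.1 ≤ s ∧ t < p.2} = ENNReal.ofReal (cdf μ s - cdf ν t) := by
  rw [quantileCoupling, Measure.map_apply_of_aemeasurable (aemeasurable_quantile_prodMk μ ν)
    (measurableSet_le_and_lt measurable_snd measurable_fst measurable_const measurable_const),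
    ← unitUniform_Ioc (cdf_nonneg ν t) (cdf_le_one μ s)]
  refine measure_congr ?_
  filter_upwards [ae_unitUniform] with u hu
  refine propext ?_
  change (quantile μ u ≤ s ∧ t < quantile ν u) ↔ (cdf ν t < u ∧ u ≤ cdf μ s)
  rw [quantile_le_iff μ hu, ← not_le, quantile_le_iff ν hu, not_le, and_comm]

theorem ofReal_cdf_map_sub_le {Ω : Type*} [MeasurableSpace Ω] (P : Measure Ω)
    [IsProbabilityMeasure P] {X Y : Ω → ℝ} (hX : Measurable X) (hY : Measurable Y) (s t : ℝ) :
    ENNReal.ofReal (cdf (P.map Y) s - cdf (P.map X) t) ≤ P {a | Y a ≤ s ∧ t < X a} := by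
  have := Measure.isProbabilityMeasure_map (μ := P) hX.aemeasurable
  have := Measure.isProbabilityMeasure_map (μ := P) hY.aemeasurable
  rw [ENNReal.ofReal_sub _ (cdf_nonneg _ _), ofReal_cdf, ofReal_cdf,
    Measure.map_apply hX measurableSet_Iic, Measure.map_apply hY measurableSet_Iic,
    tsub_le_iff_right]
  refine (measure_mono fun a (ha : Y a ≤ s) => ?_).trans (measure_union_le _ _)
  rcases le_or_gt (X a) t with h | h
  · exact Or.inr h
  · exact Or.inl ⟨ha, h⟩

/-- The comonotone coupling minimizes the quadratic transportation cost. -/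
theorem lintegral_quantileCoupling_le (μ ν : Measure ℝ) (π : Measure (ℝ × ℝ))
    [IsProbabilityMeasure π] (h1 : π.map Prod.fst = μ) (h2 : π.map Prod.snd = ν) :
    ∫⁻ p, ENNReal.ofReal (|p.1 - p.2| ^ 2) ∂(quantileCoupling μ ν)
      ≤ ∫⁻ p, ENNReal.ofReal (|p.1 - p.2| ^ 2) ∂π := by
  simp only [ENNReal.ofReal_abs_sub_sq]
  rw [lintegral_add_left (by fun_prop), lintegral_add_left (by fun_prop),
    lintegral_ofReal_sub_sq _ measurable_fst measurable_snd,
    lintegral_ofReal_sub_sq _ measurable_snd measurable_fst,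
    lintegral_ofReal_sub_sq _ measurable_fst measurable_snd,
    lintegral_ofReal_sub_sq _ measurable_snd measurable_fst]
  refine add_le_add (lintegral_mono fun z => ?_) (lintegral_mono fun z => ?_)
  · rw [quantileCoupling_snd_le_lt_fst, ← h1, ← h2]
    exact ofReal_cdf_map_sub_le π measurable_fst measurable_snd _ _
  · rw [quantileCoupling_fst_le_lt_snd, ← h1, ← h2]
    exact ofReal_cdf_map_sub_le π measurable_snd measurable_fst _ _

/-! ### Isometric embedding of the Wasserstein space into L²(0,1). -/

namespace Wasserstein2

theorem integrable_abs_sub_sq (μ ν : Wasserstein2) {π : Measure (ℝ × ℝ)}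
    (h1 : π.map Prod.fst = μ.measure) (h2 : π.map Prod.snd = ν.measure) :
    Integrable (fun p : ℝ × ℝ => |p.1 - p.2| ^ 2) π := by
  have i1 : Integrable (fun p : ℝ × ℝ => p.1 ^ 2) π := by
    have := μ.integrable_sq
    rw [← h1] at this
    exact this.comp_measurable measurable_fst
  have i2 : Integrable (fun p : ℝ × ℝ => p.2 ^ 2) π := by
    have := ν.integrable_sq
    rw [← h2] at this
    exact this.comp_measurable measurable_snd
  refine ((i1.const_mul 2).add (i2.const_mul 2)).mono' (by fun_prop)
    (Filter.Eventually.of_forall fun p => ?_)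
  rw [Real.norm_of_nonneg (by positivity), sq_abs]
  have := sq_nonneg (p.1 + p.2)
  simp only [Pi.add_apply]
  nlinarith

theorem cost_eq_integral_quantileCoupling (μ ν : Wasserstein2) :
    cost μ ν = ∫ p, |p.1 - p.2| ^ 2 ∂(quantileCoupling μ.measure ν.measure) := by
  refine IsLeast.csInf_eq ⟨⟨⟨quantileCoupling μ.measure ν.measure, inferInstance⟩,
    ⟨map_fst_quantileCoupling _ _, map_snd_quantileCoupling _ _⟩, rfl⟩, ?_⟩
  rintro _ ⟨π, ⟨h1, h2⟩, rfl⟩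
  have hnn (P : Measure (ℝ × ℝ)) : 0 ≤ᵐ[P] fun p : ℝ × ℝ => |p.1 - p.2| ^ 2 :=
    Filter.Eventually.of_forall fun p => by positivity
  have hi := integrable_abs_sub_sq μ ν h1 h2
  simp only
  rw [integral_eq_lintegral_of_nonneg_ae (hnn _) (by fun_prop),
    integral_eq_lintegral_of_nonneg_ae (hnn _) (by fun_prop)]
  -- Since `toReal` sends `∞` to 0, the competitor's cost must be known to be finite.
  refine ENNReal.toReal_mono ?_ (lintegral_quantileCoupling_le _ _ _ h1 h2)
  rw [← ofReal_integral_eq_lintegral_ofReal hi (hnn _)]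
  exact ENNReal.ofReal_ne_top

theorem memLp_quantile (μ : Wasserstein2) : MemLp (quantile μ.measure) 2 unitUniform := by
  rw [memLp_two_iff_integrable_sq (aemeasurable_quantile _).aestronglyMeasurable]
  have := μ.integrable_sq
  rw [← map_quantile (μ.measure : Measure ℝ)] at this
  exact this.comp_aemeasurable (aemeasurable_quantile _)

/-- The isometric embedding of the Wasserstein space of the line into a Hilbert space by quantile
functions. -/
noncomputable def toL2 (μ : Wasserstein2) : Lp ℝ 2 unitUniform := (memLp_quantile μ).toLp

theorem cost_eq_norm_sub_sq (μ ν : Wasserstein2) : cost μ ν = ‖toL2 μ - toL2 ν‖ ^ 2 := by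
  rw [cost_eq_integral_quantileCoupling, quantileCoupling,
    integral_map (aemeasurable_quantile_prodMk _ _) (by fun_prop), toL2, toL2, ← MemLp.toLp_sub,
    ← real_inner_self_eq_norm_sq, L2.inner_def]
  refine integral_congr_ae ?_
  filter_upwards [((memLp_quantile μ).sub (memLp_quantile ν)).coeFn_toLp] with u hu
  rw [hu, real_inner_self_eq_norm_sq, Real.norm_eq_abs, Pi.sub_apply]

theorem dist_rpow (μ ν : Wasserstein2) (H : ℝ) :
    dist μ ν ^ (2 * H) = (‖toL2 μ - toL2 ν‖ ^ 2) ^ H := by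
  have : dist μ ν = ‖toL2 μ - toL2 ν‖ := by
    change Real.sqrt (cost μ ν) = _
    rw [cost_eq_norm_sub_sq, Real.sqrt_sq (norm_nonneg _)]
  rw [this, Real.rpow_mul (norm_nonneg _), Real.rpow_two]

instance : Nonempty Wasserstein2 :=
  ⟨⟨⟨Measure.dirac 0, inferInstance⟩, integrable_dirac (by simp)⟩⟩

theorem isNegativeType_dist_rpow {H : ℝ} (hH : 0 < H) (hH1 : H ≤ 1) :
    IsNegativeType fun μ ν : Wasserstein2 => dist μ ν ^ (2 * H) := by
  simpa only [dist_rpow] using (isNegativeType_norm_sub_sq toL2).rpow hH hH1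

end Wasserstein2

/-! ### Stationarity and conclusion. -/

theorem isStationaryProcess_of_covariance_eq {E Ω : Type*} [Dist E] [MeasurableSpace Ω]
    {P : Measure Ω} {X : E → Ω → ℝ} (hX : IsGaussianProcess X P) {m : ℝ}
    (hm : ∀ x, ∫ a, X x a ∂P = m) {φ : ℝ → ℝ}
    (hφ : ∀ x y, covariance (X x) (X y) P = φ (dist x y)) : IsStationaryProcess X P :=
  ⟨fun x => (hX.hasGaussianLaw_eval x).memLp_two, ⟨m, hm⟩,
    fun g hg x y => by rw [hφ, hφ, hg]⟩

theorem mainTheorem3 :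
    (∀ (F : ℝ → ℝ) (H : ℝ), IsCompletelyMonotone F → 0 < H → H ≤ 1 →
      IsCovarianceKernel (fun μ ν : Wasserstein2 => F (dist μ ν ^ (2 * H))) ∧
      ∀ (Ω : Type*) [MeasurableSpace Ω] (P : Measure Ω) [IsProbabilityMeasure P]
        (X : Wasserstein2 → Ω → ℝ) (m : ℝ),
        IsGaussianProcess X P →
        (∀ μ, ∫ a, X μ a ∂P = m) →
        (∀ μ ν, covariance (X μ) (X ν) P = F (dist μ ν ^ (2 * H))) →
        IsStationaryProcess X P) ∧
    (∀ l H : ℝ, 0 < l → 0 < H → H ≤ 1 →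
      IsCovarianceKernel (fun μ ν : Wasserstein2 => Real.exp (-l * dist μ ν ^ (2 * H))) ∧
      ∀ (Ω : Type*) [MeasurableSpace Ω] (P : Measure Ω) [IsProbabilityMeasure P]
        (X : Wasserstein2 → Ω → ℝ) (m : ℝ),
        IsGaussianProcess X P →
        (∀ μ, ∫ a, X μ a ∂P = m) →
        (∀ μ ν, covariance (X μ) (X ν) P = Real.exp (-l * dist μ ν ^ (2 * H))) →
        IsStationaryProcess X P) := by
  refine ⟨fun F H hF hH hH1 => ⟨?_, ?_⟩, fun l H hl hH hH1 => ⟨?_, ?_⟩⟩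
  · exact hF.comp_negativeType (Wasserstein2.isNegativeType_dist_rpow hH hH1)
  · intro Ω _ P _ X m hX hm hcov
    exact isStationaryProcess_of_covariance_eq hX hm (φ := fun d => F (d ^ (2 * H))) hcov
  · simpa only [neg_mul] using (Wasserstein2.isNegativeType_dist_rpow hH hH1).exp_neg hl.le
  · intro Ω _ P _ X m hX hm hcov
    exact isStationaryProcess_of_covariance_eq hX hm
      (φ := fun d => Real.exp (-l * d ^ (2 * H))) hcov
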